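/- Let $X$ be a reflexive real Banach space with continuous dual $X^*$. For a set-valued operator $A\colon X\rightrightarrows X^*$ (that is, $Ax\subseteq X^*$ for every $x\in X$), write $\operatorname{gra}A=\{(x,x^*)\in X\times X^* : x^*\in Ax\}$ and $\operatorname{dom}A=\{x\in X : Ax\neq\varnothing\}$. The operator $A$ is a linear relation if $\operatorname{gra}A$ is a linear subspace of $X\times X^*$. An operator from a real Banach space $Z$ to its dual $Z^*$ is monotone if $\langle x-y,x^*-y^*\rangle\ge 0$ for all $(x,x^*),(y,y^*)$ in its graph, and maximally monotone if it is monotone and its graph is not properly contained in the graph of another monotone operator $Z\rightrightarrows Z^*$. The adjoint $A^*\colon X^{**}\rightrightarrows X^*$ is defined by $$\operatorname{gra}A^*=\{(x^{**},x^*)\in X^{**}\times X^* : \langle x^*,y\rangle-\langle x^{**},y^*\rangle=0\ \text{ for all }(y,y^*)\in\operatorname{gra}A\};$$ when its monotonicity is discussed, $A^*$ is regarded as an operator $X^{**}\rightrightarrows X^{***}$ through the canonical embedding $X^*\hookrightarrow X^{***}$. Corollary 5.11. Let $A\colon X\rightrightarrows X^*$ be a monotone linear relation such that $\operatorname{gra}A$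 is closed in $X\times X^*$ and $\operatorname{dom}A$ is closed in $X$ (for the norm topologies). Then the following are equivalent: 1. $A$ is maximally monotone. 2. $A^*$ is monotone. 3. $A^*$ is maximally monotone. 4. $A0=A^*0$. -/

import Mathlib

open NormedSpace

noncomputable section

/-- A set-valued operator `A : X ⇉ Y`, assigning to each point of `X` a subset of `Y`. -/
abbrev SetValued (X Y : Type*) := X → Set Y

namespace SetValued

/-- The graph of a set-valued operator. -/
def graph {X Y : Type*} (A : SetValued X Y) : Set (X × Y) :=
  {p | p.2 ∈ A p.1}

/-- The domain of a set-valued operator. -/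
def dom {X Y : Type*} (A : SetValued X Y) : Set X :=
  {x | (A x).Nonempty}

/-- `A` is a linear relation: its graph is a (not necessarily closed) real linear subspace. -/
def IsLinearRelation {X Y : Type*} [AddCommGroup X] [Module ℝ X] [AddCommGroup Y] [Module ℝ Y]
    (A : SetValued X Y) : Prop :=
  ∃ S : Submodule ℝ (X × Y), (S : Set (X × Y)) = A.graph

/-- An operator `A : Z ⇉ Z*` is monotone: `⟨x - y, x* - y*⟩ ≥ 0` for all
`(x, x*), (y, y*)` in its graph. -/
def IsMonotone {Z : Type*} [NormedAddCommGroup Z] [NormedSpace ℝ Z]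
    (A : SetValued Z (StrongDual ℝ Z)) : Prop :=
  ∀ p ∈ A.graph, ∀ q ∈ A.graph, 0 ≤ (p.2 - q.2) (p.1 - q.1)

/-- An operator `A : Z ⇉ Z*` is maximally monotone: it is monotone and no monotone operator
(linear or not) has a strictly larger graph. -/
def IsMaximallyMonotone {Z : Type*} [NormedAddCommGroup Z] [NormedSpace ℝ Z]
    (A : SetValued Z (StrongDual ℝ Z)) : Prop :=
  A.IsMonotone ∧ ∀ B : SetValued Z (StrongDual ℝ Z),
    B.IsMonotone → A.graph ⊆ B.graph → A.graph = B.graph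

/-- The adjoint `A* : X** ⇉ X*` of `A : X ⇉ X*`: the pair `(x**, x*)` is in its graph iff
`(x*, -x**)`, as a functional on `X × X*`, vanishes on the graph of `A`. -/
def adjoint {X : Type*} [NormedAddCommGroup X] [NormedSpace ℝ X]
    (A : SetValued X (StrongDual ℝ X)) :
    SetValued (StrongDual ℝ (StrongDual ℝ X)) (StrongDual ℝ X) :=
  fun xss => {xs | ∀ p ∈ A.graph, xs p.1 + (-xss) p.2 = 0}

/-- An operator `X** ⇉ X*` regarded as an operator `X** ⇉ X***`, through the canonical
embedding of `X*` in its bidual `X***`. In this form the notions of monotonicity and maximal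
monotonicity, which are about operators from a space to its dual, apply to the adjoint. -/
def toTripleDual {X : Type*} [NormedAddCommGroup X] [NormedSpace ℝ X]
    (C : SetValued (StrongDual ℝ (StrongDual ℝ X)) (StrongDual ℝ X)) :
    SetValued (StrongDual ℝ (StrongDual ℝ X))
      (StrongDual ℝ (StrongDual ℝ (StrongDual ℝ X))) :=
  fun xss => inclusionInDoubleDual ℝ (StrongDual ℝ X) '' C xss

end SetValued

/-- A normed space is reflexive: the canonical embedding in its bidual is onto. -/
def IsReflexiveSpace (X : Type*) [NormedAddCommGroup X] [NormedSpace ℝ X] : Prop :=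
  Function.Surjective (inclusionInDoubleDual ℝ X)

end

open NormedSpace

namespace SetValued

section Monotone

variable {Z : Type*} [NormedAddCommGroup Z] [NormedSpace ℝ Z] {A : SetValued Z (StrongDual ℝ Z)}

/-! The hub is condition 4. Always `A*0 = (dom A)^⊥`, and monotonicity gives `A0 ⊆ (dom A)^⊥`, so 4
asks only for the reverse inclusion. Maximality forces it (`IsMaximallyMonotone.mem_zero`), and so
does monotonicity of `A*`, by separation from the closed graph (`adjoint_zero_subset`).

Conversely, under 4 the closed domain equals `(A0)^⊥`, and a monotone linear relation whose domain
and values at zero annihilate each other is maximal (`IsMonotone.isMaximallyMonotone`). The same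
criterion serves `A*`: the open mapping theorem and Hahn-Banach give `dom A* = (A0)^⊥ = dom A`, up
to reflexivity. -/

theorem eq_zero_of_forall_mul_le {c d : ℝ} (h : ∀ t : ℝ, t * c ≤ d) : c = 0 := by
  by_contra hc
  have := h ((d + 1) / c)
  rw [div_mul_cancel₀ _ hc] at this
  linarith

theorem mem_of_coe_eq_graph {X Y : Type*} [AddCommGroup X] [Module ℝ X] [AddCommGroup Y]
    [Module ℝ Y] {B : SetValued X Y} {S : Submodule ℝ (X × Y)}
    (hS : (S : Set (X × Y)) = B.graph) {x : X} {y : Y} (h : y ∈ B x) : (x, y) ∈ S := by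
  rw [← SetLike.mem_coe, hS]
  exact h

theorem coe_map_fst_eq_dom {X Y : Type*} [AddCommGroup X] [Module ℝ X] [AddCommGroup Y]
    [Module ℝ Y] {B : SetValued X Y} {S : Submodule ℝ (X × Y)}
    (hS : (S : Set (X × Y)) = B.graph) : (S.map (LinearMap.fst ℝ X Y) : Set X) = B.dom := by
  ext x
  constructor
  · rintro ⟨p, hp, rfl⟩
    exact ⟨p.2, (hS ▸ hp : p ∈ B.graph)⟩
  · rintro ⟨y, hy⟩
    exact ⟨(x, y), mem_of_coe_eq_graph hS hy, rfl⟩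

theorem IsMonotone.nonneg_of_mem {S : Submodule ℝ (Z × StrongDual ℝ Z)}
    (hS : (S : Set (Z × StrongDual ℝ Z)) = A.graph) (hA : A.IsMonotone)
    {p : Z × StrongDual ℝ Z} (hp : p ∈ S) : 0 ≤ p.2 p.1 := by
  have h := hA p (hS ▸ hp) 0 (hS ▸ S.zero_mem)
  simpa using h

theorem isMonotone_of_nonneg {S : Submodule ℝ (Z × StrongDual ℝ Z)}
    (hS : (S : Set (Z × StrongDual ℝ Z)) = A.graph) (h : ∀ p ∈ S, 0 ≤ p.2 p.1) :
    A.IsMonotone := by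
  intro p hp q hq
  rw [← hS] at hp hq
  exact h (p - q) (S.sub_mem hp hq)

/-- The values at zero of a monotone linear relation annihilate its domain. -/
theorem IsMonotone.apply_eq_zero {S : Submodule ℝ (Z × StrongDual ℝ Z)}
    (hS : (S : Set (Z × StrongDual ℝ Z)) = A.graph) (hA : A.IsMonotone)
    {a : StrongDual ℝ Z} (ha : a ∈ A 0) {x : Z} (hx : x ∈ A.dom) : a x = 0 := by
  obtain ⟨y, hy⟩ := hx
  have ha' : ((0 : Z), a) ∈ S := mem_of_coe_eq_graph hS ha
  have hy' : (x, y) ∈ S := mem_of_coe_eq_graph hS hy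
  refine eq_zero_of_forall_mul_le (d := y x) fun t ↦ ?_
  have h := hA.nonneg_of_mem hS (S.sub_mem hy' (S.smul_mem t ha'))
  simpa using h

/-- A monotone linear relation is maximally monotone as soon as its domain and its set of values
at zero are annihilators of each other. -/
theorem IsMonotone.isMaximallyMonotone {S : Submodule ℝ (Z × StrongDual ℝ Z)}
    (hS : (S : Set (Z × StrongDual ℝ Z)) = A.graph) (hA : A.IsMonotone)
    (hdom : ∀ z, (∀ a ∈ A 0, a z = 0) → z ∈ A.dom)
    (hzero : ∀ a : StrongDual ℝ Z, (∀ x ∈ A.dom, a x = 0) → a ∈ A 0) :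
    A.IsMaximallyMonotone := by
  refine ⟨hA, fun B hB hAB ↦ hAB.antisymm ?_⟩
  rintro ⟨z, w⟩ hzw
  have key : ∀ p ∈ S, 0 ≤ (w - p.2) (z - p.1) := fun p hp ↦ hB _ hzw _ (hAB (hS ▸ hp))
  have hz : z ∈ A.dom := by
    refine hdom z fun a ha ↦ eq_zero_of_forall_mul_le (d := w z) fun t ↦ ?_
    have ha' : ((0 : Z), a) ∈ S := mem_of_coe_eq_graph hS ha
    have h := key _ (S.smul_mem t ha')
    simpa using h
  obtain ⟨v, hv⟩ := hz
  have hv' : (z, v) ∈ S := mem_of_coe_eq_graph hS hv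
  have hwv : w - v ∈ A 0 := by
    refine hzero _ fun y hy ↦ ?_
    obtain ⟨u, hu⟩ := hy
    have hu' : (y, u) ∈ S := mem_of_coe_eq_graph hS hu
    -- Test `(z, w)` against `(z - t y, v - t u)`, which lies in the graph by linearity.
    have hquad : ∀ t : ℝ, 0 ≤ t * (w - v) y + t * t * u y := fun t ↦ by
      have h := key _ (S.sub_mem hv' (S.smul_mem t hu'))
      simp only [Prod.fst_sub, Prod.snd_sub, Prod.smul_fst, Prod.smul_snd, sub_sub_cancel,
        map_smul, smul_eq_mul, sub_apply,
        smul_apply] at h ⊢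
      linarith
    generalize (w - v) y = c at hquad
    have hu0 : 0 ≤ u y := hA.nonneg_of_mem hS hu'
    generalize u y = d at hquad hu0
    -- The denominator `d + 1` stays positive even when `d = 0`, and the quadratic then equals `-(c
    -- / (d + 1))^2`.
    have h := hquad (-c / (d + 1))
    have hd : 0 < d + 1 := by linarith
    have heq : -c / (d + 1) * c + -c / (d + 1) * (-c / (d + 1)) * d
        = -(c / (d + 1)) ^ 2 := by
      field_simp
      ring
    rw [heq] at h
    have hc : c / (d + 1) = 0 := by
      refine pow_eq_zero_iff two_ne_zero |>.1 (le_antisymm ?_ (sq_nonneg _))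
      linarith
    simpa [hd.ne'] using hc
  have hwv' : ((0 : Z), w - v) ∈ S := mem_of_coe_eq_graph hS hwv
  have h := S.add_mem hv' hwv'
  rw [← hS]
  simpa using h

/-- A functional annihilating the domain of a maximally monotone linear relation is a value
at zero. -/
theorem IsMaximallyMonotone.mem_zero {S : Submodule ℝ (Z × StrongDual ℝ Z)}
    (hS : (S : Set (Z × StrongDual ℝ Z)) = A.graph) (hA : A.IsMaximallyMonotone)
    {a : StrongDual ℝ Z} (ha : ∀ x ∈ A.dom, a x = 0) : a ∈ A 0 := by
  let T : Submodule ℝ (Z × StrongDual ℝ Z) := S ⊔ Submodule.span ℝ {((0 : Z), a)}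
  have hT : (T : Set (Z × StrongDual ℝ Z)) =
      graph (fun x ↦ {y | (x, y) ∈ T} : SetValued Z (StrongDual ℝ Z)) := rfl
  have hle : A.graph ⊆ (T : Set _) := hS ▸ (le_sup_left : S ≤ T)
  -- Adding a multiple of `(0, a)` leaves the pairing unchanged, since `a` vanishes on the domain.
  have hmono : ∀ p ∈ T, 0 ≤ p.2 p.1 := by
    intro p hp
    obtain ⟨q, hq, r, hr, rfl⟩ := Submodule.mem_sup.1 hp
    obtain ⟨t, rfl⟩ := Submodule.mem_span_singleton.1 hr
    have h0 : a q.1 = 0 := ha _ ⟨q.2, (hS ▸ hq : q ∈ A.graph)⟩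
    have h := hA.1.nonneg_of_mem hS hq
    simpa [h0] using h
  have heq := hA.2 _ (isMonotone_of_nonneg hT hmono) hle
  have hmem : ((0 : Z), a) ∈ T :=
    (le_sup_right : _ ≤ T) (Submodule.mem_span_singleton_self _)
  rw [← SetLike.mem_coe, hT, ← heq] at hmem
  exact hmem

end Monotone

/-! ### The adjoint: values at zero and domain -/

section Adjoint

set_option maxSynthPendingDepth 3

variable {X : Type*} [NormedAddCommGroup X] [NormedSpace ℝ X] {A : SetValued X (StrongDual ℝ X)}

theorem mem_adjoint {z : StrongDual ℝ (StrongDual ℝ X)} {w : StrongDual ℝ X} :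
    w ∈ A.adjoint z ↔ ∀ p ∈ A.graph, w p.1 = z p.2 := by
  refine forall₂_congr fun p _ ↦ ?_
  rw [neg_apply, ← sub_eq_add_neg, sub_eq_zero]

theorem mem_adjoint_zero {w : StrongDual ℝ X} :
    w ∈ A.adjoint 0 ↔ ∀ x ∈ A.dom, w x = 0 := by
  rw [mem_adjoint]
  exact ⟨fun h x ⟨y, hy⟩ ↦ h (x, y) hy, fun h p hp ↦ h p.1 ⟨p.2, hp⟩⟩

theorem dom_toTripleDual (C : SetValued (StrongDual ℝ (StrongDual ℝ X)) (StrongDual ℝ X)) :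
    C.toTripleDual.dom = C.dom := by
  ext z
  exact Set.image_nonempty

theorem isLinearRelation_toTripleDual_adjoint : A.adjoint.toTripleDual.IsLinearRelation := by
  refine ⟨⟨⟨⟨A.adjoint.toTripleDual.graph, ?_⟩, ?_⟩, ?_⟩, rfl⟩
  · rintro ⟨z, _⟩ ⟨z', _⟩ ⟨w, hw, rfl⟩ ⟨w', hw', rfl⟩
    refine ⟨w + w', mem_adjoint.2 fun p hp ↦ ?_, map_add _ _ _⟩
    simp [mem_adjoint.1 hw p hp, mem_adjoint.1 hw' p hp]
  · exact ⟨0, mem_adjoint.2 fun p hp ↦ by simp, map_zero _⟩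
  · rintro t ⟨z, _⟩ ⟨w, hw, rfl⟩
    refine ⟨t • w, mem_adjoint.2 fun p hp ↦ ?_, map_smul _ _ _⟩
    simp [mem_adjoint.1 hw p hp]

/-- If the adjoint of a closed linear relation is monotone, then every functional annihilating
the domain of the relation is a value at zero. -/
theorem adjoint_zero_subset {S : Submodule ℝ (X × StrongDual ℝ X)}
    (hS : (S : Set (X × StrongDual ℝ X)) = A.graph) (hclosed : IsClosed A.graph)
    (hadj : SetValued.IsMonotone (Z := StrongDual ℝ (StrongDual ℝ X)) A.adjoint.toTripleDual) :
    A.adjoint 0 ⊆ A 0 := by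
  intro a ha
  by_contra hna
  have hna' : ((0 : X), a) ∉ S := fun h ↦
    hna (show ((0 : X), a) ∈ A.graph from hS ▸ h)
  have : IsClosed (S : Set (X × StrongDual ℝ X)) := hS ▸ hclosed
  obtain ⟨f, hf0, hf⟩ : ∃ f : StrongDual ℝ (X × StrongDual ℝ X),
      f (0, a) ≠ 0 ∧ ∀ p ∈ S, f p = 0 := by
    obtain ⟨f, u, hf, hu⟩ := geometric_hahn_banach_closed_point S.convex this hna'
    have h0 : 0 < u := by simpa using hf 0 S.zero_mem
    refine ⟨f, (h0.trans hu).ne', fun p hp ↦ ?_⟩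
    refine eq_zero_of_forall_mul_le (d := u) fun t ↦ ?_
    simpa using (hf _ (S.smul_mem t hp)).le
  -- Split as `f = (w, -z)`, the functional puts `z` in `dom A*` with `z a ≠ 0`; but `a ∈ A*0` must
  -- annihilate `dom A*` when `A*` is monotone.
  let w : StrongDual ℝ X := f.comp (ContinuousLinearMap.inl ℝ X (StrongDual ℝ X))
  let z : StrongDual ℝ (StrongDual ℝ X) :=
    -f.comp (ContinuousLinearMap.inr ℝ X (StrongDual ℝ X))
  have hw : w ∈ A.adjoint z := by
    refine mem_adjoint.2 fun p hp ↦ ?_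
    have h := hf p (mem_of_coe_eq_graph hS hp)
    have hp' : p = (p.1, 0) + (0, p.2) := by simp
    rw [hp', map_add] at h
    exact eq_neg_of_add_eq_zero_left h
  have hz : z ∈ A.adjoint.toTripleDual.dom := by
    rw [dom_toTripleDual]
    exact ⟨w, hw⟩
  obtain ⟨T, hT⟩ := isLinearRelation_toTripleDual_adjoint (A := A)
  have h := IsMonotone.apply_eq_zero (Z := StrongDual ℝ (StrongDual ℝ X)) hT hadj
    (a := inclusionInDoubleDual ℝ (StrongDual ℝ X) a)
    ⟨a, ha, rfl⟩ (x := z) hz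
  apply hf0
  simpa [z] using h

/-- Points annihilated by the values at zero of a closed linear relation with closed domain
belong to the domain of its adjoint. -/
theorem inclusionInDoubleDual_mem_dom_adjoint [CompleteSpace X]
    {S : Submodule ℝ (X × StrongDual ℝ X)}
    (hS : (S : Set (X × StrongDual ℝ X)) = A.graph) (hclosed : IsClosed A.graph)
    (hdom : IsClosed A.dom) {z : X} (hz : ∀ a ∈ A 0, a z = 0) :
    inclusionInDoubleDual ℝ X z ∈ A.adjoint.dom := by
  let D : Submodule ℝ X := S.map (LinearMap.fst ℝ X (StrongDual ℝ X))
  have hD : (D : Set X) = A.dom := coe_map_fst_eq_dom hS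
  rw [← hS] at hclosed
  rw [← hD] at hdom
  have : CompleteSpace S := hclosed.completeSpace_coe
  have : CompleteSpace D := hdom.completeSpace_coe
  let π : S →L[ℝ] D := ((ContinuousLinearMap.fst ℝ X (StrongDual ℝ X)).comp S.subtypeL).codRestrict
    D fun p ↦ ⟨p, p.2, rfl⟩
  have hπ : Function.Surjective π := by
    rintro ⟨_, p, hp, rfl⟩
    exact ⟨⟨p, hp⟩, rfl⟩
  -- The section `s` is only linear. Pairing values of `A` with `z` is independent of the choice of
  -- value, so the bound on open-mapping preimages makes `f` continuous.
  obtain ⟨C, -, hC⟩ := π.exists_preimage_norm_le hπ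
  obtain ⟨s, hs⟩ := (π : S →ₗ[ℝ] D).exists_rightInverse_of_surjective
    (LinearMap.range_eq_top.2 hπ)
  have hval : ∀ p q : S, π p = π q →
      (p : X × StrongDual ℝ X).2 z = (q : X × StrongDual ℝ X).2 z := by
    intro p q hpq
    have h1 : (p : X × StrongDual ℝ X).1 = (q : X × StrongDual ℝ X).1 := congrArg Subtype.val hpq
    have h2 : (p : X × StrongDual ℝ X) - q ∈ A.graph := hS ▸ S.sub_mem p.2 q.2
    have h3 : (p : X × StrongDual ℝ X).2 - (q : X × StrongDual ℝ X).2 ∈ A 0 := by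
      have : ((p : X × StrongDual ℝ X) - q).1 = 0 := by rw [Prod.fst_sub, h1, sub_self]
      rw [← this]
      exact h2
    exact sub_eq_zero.1 (hz _ h3)
  have hsπ : ∀ y, π (s y) = y := fun y ↦ LinearMap.congr_fun hs y
  let f : D →ₗ[ℝ] ℝ := ((inclusionInDoubleDual ℝ X z : StrongDual ℝ X →ₗ[ℝ] ℝ) ∘ₗ
    LinearMap.snd ℝ X (StrongDual ℝ X) ∘ₗ S.subtype) ∘ₗ s
  have hf : ∀ p : S, f (π p) = (p : X × StrongDual ℝ X).2 z := fun p ↦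
    hval _ _ (hsπ _)
  let F : StrongDual ℝ D := f.mkContinuous (C * ‖z‖) fun y ↦ by
    obtain ⟨p, rfl, hp⟩ := hC y
    rw [hf]
    calc ‖(p : X × StrongDual ℝ X).2 z‖ ≤ ‖(p : X × StrongDual ℝ X).2‖ * ‖z‖ :=
          ContinuousLinearMap.le_opNorm _ _
      _ ≤ (C * ‖π p‖) * ‖z‖ := by
          gcongr
          exact (norm_snd_le (p : X × StrongDual ℝ X)).trans hp
      _ = C * ‖z‖ * ‖π p‖ := by ring
  obtain ⟨w, hw, -⟩ := exists_extension_norm_eq D F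
  refine ⟨w, mem_adjoint.2 fun p hp ↦ ?_⟩
  have hp' : p ∈ S := mem_of_coe_eq_graph hS hp
  exact (hw (π ⟨p, hp'⟩)).trans (hf ⟨p, hp'⟩)

end Adjoint

end SetValued

/-- A point annihilated by every functional annihilating a closed subspace lies in it. -/
theorem Submodule.mem_of_forall_dual_eq_zero {X : Type*} [NormedAddCommGroup X] [NormedSpace ℝ X]
    {D : Submodule ℝ X} (hD : IsClosed (D : Set X)) {z : X}
    (h : ∀ a : StrongDual ℝ X, (∀ x ∈ D, a x = 0) → a z = 0) : z ∈ D := by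
  by_contra hz
  obtain ⟨f, u, hf, hu⟩ := geometric_hahn_banach_closed_point D.convex hD hz
  have h0 : 0 < u := by simpa using hf 0 D.zero_mem
  refine (h0.trans hu).ne' (h f fun x hx ↦ ?_)
  refine SetValued.eq_zero_of_forall_mul_le (d := u) fun t ↦ ?_
  simpa using (hf _ (D.smul_mem t hx)).le

theorem IsReflexiveSpace.dual {X : Type*} [NormedAddCommGroup X] [NormedSpace ℝ X]
    (hX : IsReflexiveSpace X) : IsReflexiveSpace (StrongDual ℝ X) := by
  intro a
  refine ⟨a.comp (inclusionInDoubleDual ℝ X), ?_⟩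
  ext z
  obtain ⟨x, rfl⟩ := hX z
  rfl

/-! ### Consequences of `A0 = A*0` -/

namespace SetValued

set_option maxSynthPendingDepth 3

variable {X : Type*} [NormedAddCommGroup X] [NormedSpace ℝ X] {A : SetValued X (StrongDual ℝ X)}

theorem mem_dom_of_zero_eq_adjoint_zero {S : Submodule ℝ (X × StrongDual ℝ X)}
    (hS : (S : Set (X × StrongDual ℝ X)) = A.graph) (hdom : IsClosed A.dom)
    (h : A 0 = A.adjoint 0) {z : X} (hz : ∀ a ∈ A 0, a z = 0) : z ∈ A.dom := by
  let D : Submodule ℝ X := S.map (LinearMap.fst ℝ X (StrongDual ℝ X))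
  have hD : (D : Set X) = A.dom := coe_map_fst_eq_dom hS
  rw [← hD]
  refine Submodule.mem_of_forall_dual_eq_zero (hD.symm ▸ hdom) fun a ha ↦ hz a ?_
  rw [h, mem_adjoint_zero, ← hD]
  exact ha

theorem isMaximallyMonotone_adjoint [CompleteSpace X] (hX : IsReflexiveSpace X)
    {S : Submodule ℝ (X × StrongDual ℝ X)}
    (hS : (S : Set (X × StrongDual ℝ X)) = A.graph) (hmono : A.IsMonotone)
    (hgraph : IsClosed A.graph) (hdom : IsClosed A.dom) (h : A 0 = A.adjoint 0) :
    SetValued.IsMaximallyMonotone (Z := StrongDual ℝ (StrongDual ℝ X))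
      A.adjoint.toTripleDual := by
  obtain ⟨T, hT⟩ := isLinearRelation_toTripleDual_adjoint (A := A)
  have hadj : ∀ {z : X}, inclusionInDoubleDual ℝ X z ∈ A.adjoint.dom ↔ ∀ a ∈ A 0, a z = 0 :=
    fun {z} ↦ ⟨fun ⟨w, hw⟩ a ha ↦ by simpa using (mem_adjoint.1 hw (0, a) ha).symm,
      inclusionInDoubleDual_mem_dom_adjoint hS hgraph hdom⟩
  have hmono' : SetValued.IsMonotone (Z := StrongDual ℝ (StrongDual ℝ X))
      A.adjoint.toTripleDual := by
    refine isMonotone_of_nonneg hT ?_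
    rintro ⟨z, _⟩ hp
    rw [← SetLike.mem_coe, hT] at hp
    obtain ⟨w, hw, rfl⟩ := hp
    obtain ⟨z, rfl⟩ := hX z
    obtain ⟨y, hy⟩ := mem_dom_of_zero_eq_adjoint_zero hS hdom h (hadj.1 ⟨w, hw⟩)
    -- `A` and `A*` have the same quadratic form at a common point `z` of their domains.
    have hzy := mem_adjoint.1 hw (z, y) hy
    have hpos := hmono.nonneg_of_mem hS (mem_of_coe_eq_graph hS hy)
    simp only [dual_def] at hzy ⊢
    rw [hzy]
    exact hpos
  refine hmono'.isMaximallyMonotone hT (fun z hz ↦ ?_) fun a ha ↦ ?_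
  · rw [dom_toTripleDual]
    obtain ⟨z, rfl⟩ := hX z
    refine hadj.2 fun a ha ↦ ?_
    exact hz (inclusionInDoubleDual ℝ (StrongDual ℝ X) a) ⟨a, h ▸ ha, rfl⟩
  -- Since `dom A ⊆ dom A*`, annihilating `dom A*` implies annihilating `dom A`, that is, lying in
  -- `A*0`.
  · obtain ⟨a, rfl⟩ := hX.dual a
    refine ⟨a, mem_adjoint_zero.2 fun x hx ↦ ?_, rfl⟩
    refine ha (inclusionInDoubleDual ℝ X x) ?_
    rw [dom_toTripleDual]
    exact hadj.2 fun b hb ↦ hmono.apply_eq_zero hS hb hx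

end SetValued

theorem corollary5p11 {X : Type*} [NormedAddCommGroup X] [NormedSpace ℝ X] [CompleteSpace X]
    (hX : IsReflexiveSpace X) (A : SetValued X (StrongDual ℝ X))
    (hlin : A.IsLinearRelation) (hmono : A.IsMonotone)
    (hgraph : IsClosed A.graph) (hdom : IsClosed A.dom) :
    List.TFAE [
      A.IsMaximallyMonotone,
      SetValued.IsMonotone (Z := StrongDual ℝ (StrongDual ℝ X)) A.adjoint.toTripleDual,
      SetValued.IsMaximallyMonotone (Z := StrongDual ℝ (StrongDual ℝ X)) A.adjoint.toTripleDual,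
      A 0 = A.adjoint 0] := by
  obtain ⟨S, hS⟩ := hlin
  have hsub : A 0 ⊆ A.adjoint 0 := fun a ha ↦
    SetValued.mem_adjoint_zero.2 fun x hx ↦ hmono.apply_eq_zero hS ha hx
  tfae_have 1 → 4 := fun h ↦ hsub.antisymm fun a ha ↦
    h.mem_zero hS (SetValued.mem_adjoint_zero.1 ha)
  tfae_have 4 → 1 := fun h ↦ hmono.isMaximallyMonotone hS
    (fun z hz ↦ SetValued.mem_dom_of_zero_eq_adjoint_zero hS hdom h hz)
    fun a ha ↦ h ▸ SetValued.mem_adjoint_zero.2 ha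
  tfae_have 4 → 3 := fun h ↦ SetValued.isMaximallyMonotone_adjoint hX hS hmono hgraph hdom h
  tfae_have 3 → 2 := fun h ↦ h.1
  tfae_have 2 → 4 := fun h ↦ hsub.antisymm (SetValued.adjoint_zero_subset hS hgraph h)
  tfae_finish
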